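/- \textbf{Setting.} Let $\mathbb{X}$ be a locally compact second-countable Hausdorff group with neutral element $e$ which is unimodular, i.e. its left Haar measure $\lambda$ is also right invariant. Let $(\Omega,\mathcal{A},\mathbf{P})$ be a probability space with a jointly measurable, $\mathbf{P}$-preserving left action $\theta:\mathbb{X}\times\Omega\to\Omega$. Let $\mathfrak{m}$ be a simple point process on $\mathbb{X}$, i.e. a random locally finite counting measure without multiple points, measurable in the sense that $\omega\mapsto\mathfrak{m}(\omega,B)$ is measurable for each Borel set $B$, and identified with its set of points. Assume that $\mathfrak m$ is flow-adapted, i.e. $\mathfrak{m}(\theta_x\omega,B)=\mathfrak{m}(\omega,x^{-1}B)$ for all $x\in\mathbb{X}$, $\omega\in\Omega$ and Borel $B$, and that the measure $\mathbf{E}[\mathfrak{m}(\cdot)]$ is locally finite and non-zero. Its Palm probability measure is $$\mathbf{P}^{\mathfrak{m}}(A)=\frac{1}{c}\,\mathbf{E}\int_{\mathbb{X}}1_{\{\theta_x^{-1}\omega\in A\}}\,w(x)\,\mathfrak{m}(\omega,dx),\qquad A\in\mathcal{A},$$ where $c=\mathbf{E}[\mathfrak{m}(B)]/\lambda(B)$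 for any Borel $B$ with $\lambda(B)\in(0,\infty)$, and $w:\mathbb{X}\to[0,\infty)$ is any measurable function with $\int w\,d\lambda=1$. \textbf{Networks.} A network is a connected, locally finite simple graph (possibly empty) with marks in a fixed complete separable metric space $\Xi$ on its vertices and on its pairs (vertex, incident edge). Let $\mathcal{G}_*$ and $\mathcal{G}_{**}$ be the sets of isomorphism classes $[G,o]$ and $[G,o,v]$ of networks with one distinguished vertex $o$ and with two distinguished vertices $o,v$, respectively. They carry the Borel $\sigma$-algebras of the topologies whose neighbourhoods are given by the distance $2^{-\alpha}$. For $\mathcal{G}_*$, $\alpha$ is the supremum of those $r>0$ such that there is a rooted isomorphism between the balls of radius $\lceil r\rceil$ around the roots for which corresponding marks are at distance at most $1/r$ ($\alpha=0$ if there is no such $r$). For $\mathcal{G}_{**}$ one requires moreover that the second distinguished vertices lie in these balls and correspond to each other. A unimodular random network is a measurable map $[\boldsymbol{G},\boldsymbol{o}]$ from a probability space to $\mathcal{G}_*$ such that, for all measurable $g:\mathcal{G}_{**}\to[0,\infty)$, $$\mathbf{E}\sum_{v\in V(\boldsymbol{G})}g[\boldsymbol{G},\boldsymbol{o},v]=\mathbf{E}\sum_{v\in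 V(\boldsymbol{G})}g[\boldsymbol{G},v,\boldsymbol{o}].$$ \textbf{Theorem.} Let $\beta$ be a map on $\Omega$ such that, for every $\omega\in\Omega$, $\beta(\omega)$ is a network with mark space $\Xi$ and vertex set $V(\beta(\omega))\subseteq\mathbb{X}$, and such that \begin{enumerate} \item[(i)] $V(\beta)=\mathfrak{m}$; \item[(ii)] $\beta$ is flow-adapted: for all $z\in\mathbb{X}$ and $\omega\in\Omega$, $\beta(\theta_z\omega)$ is the network obtained from $\beta(\omega)$ by shifting each vertex $X$ to $zX$, with edges and all marks carried along; \item[(iii)] $\omega\mapsto[\beta(\omega),e]\in\mathcal{G}_*$ is measurable on the event $\{e\in V(\beta)\}$, and $(\omega,x)\mapsto[\beta(\omega),e,x]\in\mathcal{G}_{**}$ is measurable on $\{(\omega,x)\in\Omega\times\mathbb{X}: e,x\in V(\beta(\omega))\}$. \end{enumerate} Then $\mathbf{P}^{\mathfrak{m}}$ is a probability measure, the event $\{e\in V(\beta)\}=\{e\in\mathfrak{m}\}$ is measurable and has $\mathbf{P}^{\mathfrak{m}}$-probability $1$, and on this event $[\beta,e]$ is a unimodular random network under $\mathbf{P}^{\mathfrak{m}}$.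 -/

import Mathlib

open MeasureTheory Set
open scoped ENNReal NNReal Pointwise

namespace FlowNet

universe u v

/-! ## Simple point processes, flow-adaptedness, Palm probabilities -/

section PointProcess

variable {Ω : Type*} {X : Type*}

/-- The measure `B ↦ #(S ∩ B)` on `X` that counts the points of `S`. -/
noncomputable def countingMeasure [MeasurableSpace X] (S : Set X) : Measure X :=
  Measure.count.restrict S

/-- A simple point process on `X`: a random locally finite counting measure without multiple
points, given through its (locally finite) set of atoms `points ω`.  It is measurable for the
cylindrical `σ`-algebra, i.e. `ω ↦ #(points ω ∩ B)` is measurable for each Borel set `B`. -/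
structure SimplePointProcess (Ω : Type*) [MeasurableSpace Ω]
    (X : Type*) [TopologicalSpace X] [MeasurableSpace X] where
  points : Ω → Set X
  finite_inter_compact : ∀ ω, ∀ K : Set X, IsCompact K → (points ω ∩ K).Finite
  measurable_count : ∀ B : Set X, MeasurableSet B →
    Measurable fun ω => countingMeasure (points ω) B

/-- The point process as a map into the measures on `X`. -/
noncomputable def SimplePointProcess.toMeasure [MeasurableSpace Ω] [TopologicalSpace X]
    [MeasurableSpace X] (m : SimplePointProcess Ω X) (ω : Ω) : Measure X :=
  countingMeasure (m.points ω)

/-- `m (x • ω, B) = m (ω, x⁻¹ B)`; the flow is the left action `•` of `X` on `Ω`. -/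
def SimplePointProcess.FlowAdapted [MeasurableSpace Ω] [TopologicalSpace X]
    [MeasurableSpace X] [Group X] [MulAction X Ω] (m : SimplePointProcess Ω X) : Prop :=
  ∀ (x : X) (ω : Ω) (B : Set X), MeasurableSet B →
    m.toMeasure (x • ω) B = m.toMeasure ω (x⁻¹ • B)

/-- The intensity measure `B ↦ 𝐄[m(B)]`. -/
noncomputable def SimplePointProcess.meanMeasure [MeasurableSpace Ω] [TopologicalSpace X]
    [MeasurableSpace X] (m : SimplePointProcess Ω X) (P : Measure Ω) : Measure X :=
  P.bind m.toMeasure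

/-- The number `𝐄[m(B)] / haar(B)`. -/
noncomputable def SimplePointProcess.intensity [MeasurableSpace Ω] [TopologicalSpace X]
    [MeasurableSpace X] (m : SimplePointProcess Ω X) (P : Measure Ω) (haar : Measure X)
    (B : Set X) : ℝ≥0∞ :=
  m.meanMeasure P B / haar B

/-- The Palm measure of `m`,
`A ↦ (1 / intensity) * 𝐄 ∫ 1_{x⁻¹ • ω ∈ A} w(x) m(ω, dx)` (see `palm_apply`), computed with the
reference set `B` for the intensity and with the weight function `w`. -/
noncomputable def SimplePointProcess.palm [MeasurableSpace Ω] [TopologicalSpace X]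
    [MeasurableSpace X] [Group X] [MulAction X Ω] (m : SimplePointProcess Ω X) (P : Measure Ω)
    (haar : Measure X) (B : Set X) (w : X → ℝ≥0) : Measure Ω :=
  (m.intensity P haar B)⁻¹ •
    P.bind fun ω =>
      ((m.toMeasure ω).withDensity fun x => (w x : ℝ≥0∞)).map fun x => x⁻¹ • ω

theorem SimplePointProcess.measurable_toMeasure [MeasurableSpace Ω] [TopologicalSpace X]
    [MeasurableSpace X] (m : SimplePointProcess Ω X) : Measurable m.toMeasure :=
  Measure.measurable_of_measurable_coe _ m.measurable_count

/-- The point process as a kernel. -/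
noncomputable def SimplePointProcess.toKernel [MeasurableSpace Ω] [TopologicalSpace X]
    [MeasurableSpace X] (m : SimplePointProcess Ω X) : ProbabilityTheory.Kernel Ω X :=
  ⟨m.toMeasure, m.measurable_toMeasure⟩

theorem SimplePointProcess.toMeasure_compact_lt_top [MeasurableSpace Ω] [TopologicalSpace X]
    [T2Space X] [MeasurableSpace X] [BorelSpace X] (m : SimplePointProcess Ω X) (ω : Ω)
    {K : Set X} (hK : IsCompact K) : m.toMeasure ω K < ∞ := by
  rw [toMeasure, countingMeasure, Measure.restrict_apply hK.measurableSet, inter_comm]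
  exact Measure.count_apply_lt_top.2 (m.finite_inter_compact ω K hK)

instance SimplePointProcess.isSFiniteKernel_toKernel [MeasurableSpace Ω] [TopologicalSpace X]
    [T2Space X] [SigmaCompactSpace X] [MeasurableSpace X] [BorelSpace X]
    (m : SimplePointProcess Ω X) : ProbabilityTheory.IsSFiniteKernel m.toKernel := by
  classical
  let K : ℕ → Set X := disjointed (compactCovering X)
  have hc : ∀ n, MeasurableSet (compactCovering X n) := fun n =>
    (isCompact_compactCovering X n).measurableSet
  have hK : ∀ n, MeasurableSet (K n) := fun n => MeasurableSet.disjointed hc n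
  have hKfin : ∀ ω n, m.toMeasure ω (K n) < ∞ := fun ω n =>
    (measure_mono (disjointed_subset _ _)).trans_lt
      (m.toMeasure_compact_lt_top ω (isCompact_compactCovering X n))
  let S : ℕ → ℕ → Set Ω := fun n k => {ω | ⌊(m.toMeasure ω (K n)).toNNReal⌋₊ = k}
  have hS : ∀ n k, MeasurableSet (S n k) := fun n k => by
    have h : Measurable fun ω => ⌊(m.toMeasure ω (K n)).toNNReal⌋₊ :=
      Nat.measurable_floor.comp (m.measurable_count _ (hK n)).ennreal_toNNReal
    exact h (measurableSet_singleton k)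
  let κ : ℕ → ℕ → ProbabilityTheory.Kernel Ω X := fun n k =>
    ProbabilityTheory.Kernel.piecewise (hS n k) (m.toKernel.restrict (hK n)) 0
  have hκ : ∀ n k, ProbabilityTheory.IsFiniteKernel (κ n k) := fun n k => by
    refine ⟨⟨(k + 1 : ℝ≥0), ENNReal.coe_lt_top, fun ω => ?_⟩⟩
    by_cases h : ω ∈ S n k
    · simp only [κ, ProbabilityTheory.Kernel.piecewise_apply, if_pos h,
        ProbabilityTheory.Kernel.restrict_apply, Measure.restrict_apply_univ]
      change m.toMeasure ω (K n) ≤ _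
      rw [← ENNReal.coe_toNNReal (hKfin ω n).ne, ENNReal.coe_le_coe]
      have := (Nat.lt_floor_add_one (m.toMeasure ω (K n)).toNNReal).le
      rwa [show ⌊(m.toMeasure ω (K n)).toNNReal⌋₊ = k from h] at this
    · simp [κ, ProbabilityTheory.Kernel.piecewise_apply, if_neg h]
  have hsum : m.toKernel =
      ProbabilityTheory.Kernel.sum fun n => ProbabilityTheory.Kernel.sum fun k => κ n k := by
    ext ω A hA
    rw [ProbabilityTheory.Kernel.sum_apply' _ _ hA]
    have h1 : ∀ n, (ProbabilityTheory.Kernel.sum fun k => κ n k) ω A =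
        m.toKernel ω (A ∩ K n) := fun n => by
      rw [ProbabilityTheory.Kernel.sum_apply' _ _ hA,
        tsum_eq_single ⌊(m.toMeasure ω (K n)).toNNReal⌋₊]
      · simp [κ, S, ProbabilityTheory.Kernel.piecewise_apply,
          ProbabilityTheory.Kernel.restrict_apply, Measure.restrict_apply hA]
      · intro k hk
        have : ω ∉ S n k := fun h => hk h.symm
        simp [κ, ProbabilityTheory.Kernel.piecewise_apply, if_neg this]
    rw [tsum_congr h1, ← measure_iUnion]
    · rw [← inter_iUnion, iUnion_disjointed, iUnion_compactCovering, inter_univ]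
    · exact fun i j hij => (disjoint_disjointed _ hij).mono inter_subset_right inter_subset_right
    · exact fun n => hA.inter (hK n)
  rw [hsum]
  infer_instance

/-- The Palm measure is given by its defining formula. -/
theorem palm_apply [MeasurableSpace Ω] [TopologicalSpace X] [T2Space X] [SigmaCompactSpace X]
    [MeasurableSpace X] [BorelSpace X] [Group X] [IsTopologicalGroup X] [MulAction X Ω]
    [MeasurableSMul₂ X Ω] (m : SimplePointProcess Ω X) (P : Measure Ω) (haar : Measure X)
    (B : Set X) {w : X → ℝ≥0} (hw : Measurable w) {A : Set Ω} (hA : MeasurableSet A) :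
    m.palm P haar B w A = (m.intensity P haar B)⁻¹ *
      ∫⁻ ω, ∫⁻ x, A.indicator 1 (x⁻¹ • ω) * (w x : ℝ≥0∞) ∂(m.toMeasure ω) ∂P := by
  have hsm : Measurable fun p : Ω × X => p.2⁻¹ • p.1 := by
    exact measurable_snd.inv.smul measurable_fst
  have hω : ∀ ω : Ω, Measurable fun x : X => x⁻¹ • ω := fun ω => by
    exact hsm.comp (measurable_const.prodMk measurable_id)
  have key : ∀ {A : Set Ω}, MeasurableSet A → ∀ ω : Ω,
      (((m.toMeasure ω).withDensity fun x => (w x : ℝ≥0∞)).map fun x => x⁻¹ • ω) A =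
        ∫⁻ x, A.indicator 1 (x⁻¹ • ω) * (w x : ℝ≥0∞) ∂(m.toMeasure ω) := by
    intro A hA ω
    rw [Measure.map_apply (hω ω) hA, withDensity_apply _ (hω ω hA),
      ← lintegral_indicator (hω ω hA)]
    refine lintegral_congr fun x => ?_
    by_cases h : x⁻¹ • ω ∈ A <;> simp [indicator, h]
  have hmeas : Measurable fun ω =>
      ((m.toMeasure ω).withDensity fun x => (w x : ℝ≥0∞)).map fun x => x⁻¹ • ω := by
    refine Measure.measurable_of_measurable_coe _ fun A hA => ?_
    simp_rw [key hA]
    have h : Measurable fun p : Ω × X =>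
        (A.indicator 1 (p.2⁻¹ • p.1) * (w p.2 : ℝ≥0∞) : ℝ≥0∞) :=
      ((measurable_one.indicator hA).comp hsm).mul
        (hw.comp measurable_snd).coe_nnreal_ennreal
    exact Measurable.lintegral_kernel_prod_right' (κ := m.toKernel) h
  rw [SimplePointProcess.palm, Measure.smul_apply, smul_eq_mul,
    Measure.bind_apply hA hmeas.aemeasurable]
  simp_rw [key hA]

end PointProcess

/-! ## Networks and their isomorphism classes -/

/-- A connected (or empty), locally finite network with vertex set `V` and mark space `Ξ`.
`edgeMark v w h` is the mark of the pair consisting of the vertex `v` and the incident edge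
`{v, w}`. -/
structure Network (Ξ : Type v) (V : Type u) where
  graph : SimpleGraph V
  preconnected : graph.Preconnected
  locallyFinite : ∀ x, (graph.neighborSet x).Finite
  vertexMark : V → Ξ
  edgeMark : ∀ x y, graph.Adj x y → Ξ

/-- A bijection of the vertex sets is an isomorphism of networks if it preserves and reflects
edges and preserves all marks (the edge bijection is determined by the vertex bijection). -/
structure Network.IsIso {Ξ : Type v} {V V' : Type u} (N : Network Ξ V) (N' : Network Ξ V')
    (φ : V ≃ V') : Prop where
  adj_iff : ∀ x y, N.graph.Adj x y ↔ N'.graph.Adj (φ x) (φ y)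
  vertexMark_eq : ∀ x, N.vertexMark x = N'.vertexMark (φ x)
  edgeMark_eq : ∀ x y (h : N.graph.Adj x y) (h' : N'.graph.Adj (φ x) (φ y)),
    N.edgeMark x y h = N'.edgeMark (φ x) (φ y) h'

theorem Network.IsIso.refl {Ξ : Type v} {V : Type u} (N : Network Ξ V) :
    N.IsIso N (Equiv.refl V) :=
  ⟨fun _ _ => Iff.rfl, fun _ => rfl, fun _ _ _ _ => rfl⟩

theorem Network.IsIso.symm {Ξ : Type v} {V V' : Type u} {N : Network Ξ V} {N' : Network Ξ V'}
    {φ : V ≃ V'} (h : N.IsIso N' φ) : N'.IsIso N φ.symm := by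
  refine ⟨fun x y => ?_, fun x => ?_, fun x y hx hy => ?_⟩
  · simpa using (h.adj_iff (φ.symm x) (φ.symm y)).symm
  · simpa using (h.vertexMark_eq (φ.symm x)).symm
  · have := h.edgeMark_eq (φ.symm x) (φ.symm y) hy (by simpa using hx)
    simpa using this.symm

theorem Network.IsIso.trans {Ξ : Type v} {V V' V'' : Type u} {N : Network Ξ V}
    {N' : Network Ξ V'} {N'' : Network Ξ V''} {φ : V ≃ V'} {ψ : V' ≃ V''}
    (h : N.IsIso N' φ) (k : N'.IsIso N'' ψ) : N.IsIso N'' (φ.trans ψ) := by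
  refine ⟨fun x y => ?_, fun x => ?_, fun x y hx hy => ?_⟩
  · exact (h.adj_iff x y).trans (k.adj_iff _ _)
  · exact (h.vertexMark_eq x).trans (k.vertexMark_eq _)
  · have hz := (h.adj_iff x y).1 hx
    exact (h.edgeMark_eq x y hx hz).trans (k.edgeMark_eq _ _ hz hy)

/-- The vertices of the ball of radius `⌈r⌉` around `o`, for the graph distance. -/
def Network.ball {Ξ : Type v} {V : Type u} (N : Network Ξ V) (o : V) (r : ℝ) : Set V :=
  {x | N.graph.dist o x ≤ ⌈r⌉₊}

/-- `φ` is an isomorphism between the graphs induced on the balls of radius `⌈r⌉` around `o` and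
`o'` which maps `o` to `o'`, and corresponding marks are at distance at most `1 / r`. -/
structure Network.IsBallIso {Ξ : Type v} [MetricSpace Ξ] {V V' : Type u} (N : Network Ξ V)
    (o : V) (N' : Network Ξ V') (o' : V') (r : ℝ) (φ : N.ball o r ≃ N'.ball o' r) : Prop where
  adj_iff : ∀ x y, N.graph.Adj x.1 y.1 ↔ N'.graph.Adj (φ x).1 (φ y).1
  root_eq : ∀ x, x.1 = o → (φ x).1 = o'
  vertexMark_dist : ∀ x, dist (N.vertexMark x.1) (N'.vertexMark (φ x).1) ≤ 1 / r
  edgeMark_dist : ∀ x y (h : N.graph.Adj x.1 y.1) (h' : N'.graph.Adj (φ x).1 (φ y).1),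
    dist (N.edgeMark x.1 y.1 h) (N'.edgeMark (φ x).1 (φ y).1 h') ≤ 1 / r

/-- The topology in which a set is open if it contains a `d`-ball around each of its points. -/
@[reducible] def topologyOfDist {α : Type*} (d : α → α → ℝ) : TopologicalSpace α where
  IsOpen U := ∀ a ∈ U, ∃ ε > 0, ∀ b, d a b < ε → b ∈ U
  isOpen_univ := fun _ _ => ⟨1, one_pos, fun _ _ => mem_univ _⟩
  isOpen_inter := by
    rintro U W hU hW a ⟨ha, ha'⟩
    obtain ⟨ε, hε, h⟩ := hU a ha
    obtain ⟨δ, hδ, h'⟩ := hW a ha'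
    exact ⟨min ε δ, lt_min hε hδ, fun b hb =>
      ⟨h b (hb.trans_le (min_le_left _ _)), h' b (hb.trans_le (min_le_right _ _))⟩⟩
  isOpen_sUnion := by
    rintro S hS a ⟨U, hU, ha⟩
    obtain ⟨ε, hε, h⟩ := hS U hU a ha
    exact ⟨ε, hε, fun b hb => ⟨U, hU, h b hb⟩⟩

section Rooted

variable (Ξ : Type v)

/-- A rooted network. -/
structure RootedNetwork where
  V : Type u
  net : Network Ξ V
  root : V

/-- A network with an ordered pair of distinguished vertices. -/
structure BirootedNetwork where
  V : Type u
  net : Network Ξ V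
  root : V
  other : V

/-- Isomorphism of rooted networks. -/
def RootedNetwork.setoid : Setoid (RootedNetwork.{u, v} Ξ) where
  r A B := ∃ φ : A.V ≃ B.V, A.net.IsIso B.net φ ∧ φ A.root = B.root
  iseqv :=
    { refl := fun A => ⟨Equiv.refl _, .refl _, rfl⟩
      symm := by
        rintro A B ⟨φ, h, h₁⟩
        exact ⟨φ.symm, h.symm, by simp [← h₁]⟩
      trans := by
        rintro A B C ⟨φ, h, h₁⟩ ⟨ψ, k, k₁⟩
        exact ⟨φ.trans ψ, h.trans k, by simp [h₁, k₁]⟩ }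

/-- Isomorphism of birooted networks. -/
def BirootedNetwork.setoid : Setoid (BirootedNetwork.{u, v} Ξ) where
  r A B := ∃ φ : A.V ≃ B.V, A.net.IsIso B.net φ ∧ φ A.root = B.root ∧ φ A.other = B.other
  iseqv :=
    { refl := fun A => ⟨Equiv.refl _, .refl _, rfl, rfl⟩
      symm := by
        rintro A B ⟨φ, h, h₁, h₂⟩
        exact ⟨φ.symm, h.symm, by simp [← h₁], by simp [← h₂]⟩
      trans := by
        rintro A B C ⟨φ, h, h₁, h₂⟩ ⟨ψ, k, k₁, k₂⟩
        exact ⟨φ.trans ψ, h.trans k, by simp [h₁, k₁], by simp [h₂, k₂]⟩ }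

/-- The set `𝒢⁎` of isomorphism classes of rooted networks. -/
def RootedClass : Type (max (u + 1) v) := Quotient (RootedNetwork.setoid.{u, v} Ξ)

/-- The set `𝒢⁎⁎` of isomorphism classes of birooted networks. -/
def BirootedClass : Type (max (u + 1) v) := Quotient (BirootedNetwork.setoid.{u, v} Ξ)

variable {Ξ}

/-- The class `[N, o]`. -/
def rootedClass {V : Type u} (N : Network Ξ V) (o : V) : RootedClass.{u, v} Ξ :=
  Quotient.mk (RootedNetwork.setoid Ξ) ⟨V, N, o⟩

/-- The class `[N, o, x]`. -/
def birootedClass {V : Type u} (N : Network Ξ V) (o x : V) : BirootedClass.{u, v} Ξ :=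
  Quotient.mk (BirootedNetwork.setoid Ξ) ⟨V, N, o, x⟩

/-- The distance `2 ^ (-α)` on `𝒢⁎`, where `α` is the supremum of the `r > 0` for which the
`r`-balls around the roots are isomorphic up to an error of `1 / r` in the marks
(`α = 0` if there is no such `r`). -/
noncomputable def RootedClass.dist [MetricSpace Ξ] (a b : RootedClass.{u, v} Ξ) : ℝ :=
  sInf (insert 1 {s : ℝ | ∃ r > 0, s = (2 : ℝ) ^ (-r) ∧
    ∃ (V V' : Type u) (N : Network Ξ V) (N' : Network Ξ V') (o : V) (o' : V'),
      rootedClass N o = a ∧ rootedClass N' o' = b ∧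
      ∃ φ : N.ball o r ≃ N'.ball o' r, N.IsBallIso o N' o' r φ})

/-- The analogous distance on `𝒢⁎⁎`: the second distinguished vertices have to lie in the balls
and to correspond to each other. -/
noncomputable def BirootedClass.dist [MetricSpace Ξ] (a b : BirootedClass.{u, v} Ξ) : ℝ :=
  sInf (insert 1 {s : ℝ | ∃ r > 0, s = (2 : ℝ) ^ (-r) ∧
    ∃ (V V' : Type u) (N : Network Ξ V) (N' : Network Ξ V') (o x : V) (o' x' : V'),
      birootedClass N o x = a ∧ birootedClass N' o' x' = b ∧
      ∃ φ : N.ball o r ≃ N'.ball o' r, N.IsBallIso o N' o' r φ ∧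
        ∃ hx : x ∈ N.ball o r, (φ ⟨x, hx⟩).1 = x'})

noncomputable instance [MetricSpace Ξ] : TopologicalSpace (RootedClass.{u, v} Ξ) :=
  topologyOfDist RootedClass.dist

noncomputable instance [MetricSpace Ξ] : TopologicalSpace (BirootedClass.{u, v} Ξ) :=
  topologyOfDist BirootedClass.dist

noncomputable instance [MetricSpace Ξ] : MeasurableSpace (RootedClass.{u, v} Ξ) := borel _

noncomputable instance [MetricSpace Ξ] : MeasurableSpace (BirootedClass.{u, v} Ξ) := borel _

/-! ## Unimodular random networks -/

/-- `∑_{x ∈ V(G)} g [G, o, x]` as a function of `[G, o]`. -/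
noncomputable def massOut (g : BirootedClass.{u, v} Ξ → ℝ≥0) : RootedClass.{u, v} Ξ → ℝ≥0∞ :=
  Quotient.lift (fun A => ∑' x : A.V, (g (birootedClass A.net A.root x) : ℝ≥0∞)) <| by
    rintro A B ⟨φ, h, h₁⟩
    refine (tsum_congr fun x => ?_).trans
      (φ.tsum_eq fun y => (g (birootedClass B.net B.root y) : ℝ≥0∞))
    exact congrArg (fun c => (g c : ℝ≥0∞)) (Quotient.sound ⟨φ, h, h₁, rfl⟩)

/-- `∑_{x ∈ V(G)} g [G, x, o]` as a function of `[G, o]`. -/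
noncomputable def massIn (g : BirootedClass.{u, v} Ξ → ℝ≥0) : RootedClass.{u, v} Ξ → ℝ≥0∞ :=
  Quotient.lift (fun A => ∑' x : A.V, (g (birootedClass A.net x A.root) : ℝ≥0∞)) <| by
    rintro A B ⟨φ, h, h₁⟩
    refine (tsum_congr fun x => ?_).trans
      (φ.tsum_eq fun y => (g (birootedClass B.net y B.root) : ℝ≥0∞))
    exact congrArg (fun c => (g c : ℝ≥0∞)) (Quotient.sound ⟨φ, h, rfl, h₁⟩)

/-- `N` is a unimodular random network on the probability space `(S, Q)`. -/
structure IsUnimodularRandomNetwork [MetricSpace Ξ] {S : Type*} [MeasurableSpace S]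
    (Q : Measure S) (N : S → RootedClass.{u, v} Ξ) : Prop where
  isProbabilityMeasure : IsProbabilityMeasure Q
  measurable : Measurable N
  massTransport : ∀ g : BirootedClass.{u, v} Ξ → ℝ≥0, Measurable g →
    ∫⁻ s, massOut g (N s) ∂Q = ∫⁻ s, massIn g (N s) ∂Q

end Rooted

/-! ## Networks whose vertices are points of `X` -/

/-- A network whose vertex set is a subset of `X`. -/
structure NetworkIn (Ξ : Type v) (X : Type u) where
  verts : Set X
  net : Network Ξ verts

/-- The network `β (z • ω)` is the shift of `β ω` by `z`, with all marks preserved. -/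
def NetworkFlowAdapted {Ω : Type*} {Ξ : Type v} {X : Type u} [Group X] [MulAction X Ω]
    (β : Ω → NetworkIn Ξ X) : Prop :=
  ∀ (z : X) (ω : Ω),
    (β (z • ω)).verts = (fun x => z * x) '' (β ω).verts ∧
    ∀ (x y : X) (hx : x ∈ (β ω).verts) (hy : y ∈ (β ω).verts)
      (hx' : z * x ∈ (β (z • ω)).verts) (hy' : z * y ∈ (β (z • ω)).verts),
      ((β (z • ω)).net.graph.Adj ⟨z * x, hx'⟩ ⟨z * y, hy'⟩ ↔
        (β ω).net.graph.Adj ⟨x, hx⟩ ⟨y, hy⟩) ∧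
      (β (z • ω)).net.vertexMark ⟨z * x, hx'⟩ = (β ω).net.vertexMark ⟨x, hx⟩ ∧
      ∀ (h' : (β (z • ω)).net.graph.Adj ⟨z * x, hx'⟩ ⟨z * y, hy'⟩)
        (h : (β ω).net.graph.Adj ⟨x, hx⟩ ⟨y, hy⟩),
        (β (z • ω)).net.edgeMark _ _ h' = (β ω).net.edgeMark _ _ h

/-- `ω ↦ [β ω, e]` on the event `{e ∈ V(β)}`. -/
def rootedAtOne {Ω : Type*} {Ξ : Type v} {X : Type u} [One X] (β : Ω → NetworkIn Ξ X)
    (ω : {ω : Ω // (1 : X) ∈ (β ω).verts}) : RootedClass.{u, v} Ξ :=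
  rootedClass (β ω.1).net ⟨1, ω.2⟩

/-- `(ω, x) ↦ [β ω, e, x]` on `{(ω, x) | e ∈ V(β ω), x ∈ V(β ω)}`. -/
def birootedAtOne {Ω : Type*} {Ξ : Type v} {X : Type u} [One X] (β : Ω → NetworkIn Ξ X)
    (p : {p : Ω × X // (1 : X) ∈ (β p.1).verts ∧ p.2 ∈ (β p.1).verts}) :
    BirootedClass.{u, v} Ξ :=
  birootedClass (β p.1.1).net ⟨1, p.2.1⟩ ⟨p.1.2, p.2.2⟩

end FlowNet

namespace FlowNet

open ProbabilityTheory

/-! Shifting a point `y` of the process to `e` turns the root `e` into the typical point `y`: by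
flow-adaptedness `[β(y⁻¹ω), e, y⁻¹z]` equals `[β(ω), y, z]`. Put `H(ω, y, z) = g[β(ω), y, z]` for
points `y, z` of the process. Up to the factor `1/c`, the mass sent from `e` under the Palm measure
is `𝐄 ∑_{y,z} w(y) H(ω, y, z)`, and the mass received is the same sum with `w(z)` in place of
`w(y)`. Unimodularity of the network is thus the statement that the weight may be moved from sender
to receiver.

That is `FlowAdapted.massTransport`. Both `H` and the measure `P(dω) m(ω,dy) m(ω,dz)` are invariant
under the diagonal flow. Insert the factor `1 = ∫ w(sz) ds`, shift by `s`, and integrate out the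
other weight as `∫ w(s⁻¹y) ds = 1`. These two normalisations are where unimodularity of the group
enters: Haar measure must be invariant under right translations and under inversion.

That the Palm measure has total mass one comes from uniqueness of Haar measure: the mean measure is
left invariant, hence `c` times Haar measure. Measurability comes from the same shift to `e`, which
reduces statements about pairs `(ω, x)` to statements about the neutral element. -/

theorem isInvInvariant_of_isMulRightInvariant {G : Type*} [Group G] [TopologicalSpace G]
    [IsTopologicalGroup G] [LocallyCompactSpace G] [SecondCountableTopology G]
    [MeasurableSpace G] [BorelSpace G] (μ : Measure G) [μ.IsHaarMeasure]
    [μ.IsMulRightInvariant] : μ.IsInvInvariant := by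
  constructor
  let c : ℝ≥0 := Measure.haarScalarFactor μ.inv μ
  have hfin : IsFiniteMeasureOnCompacts μ.inv :=
    ⟨fun K hK => by rw [Measure.inv_apply]; exact hK.inv.measure_lt_top⟩
  -- Inversion exchanges left and right translations, so right invariance of `μ` makes `μ.inv` left
  -- invariant and uniqueness of Haar measure applies.
  have hc : μ.inv = c • μ := Measure.isMulLeftInvariant_eq_smul μ.inv μ
  let K : TopologicalSpace.PositiveCompacts G := Classical.arbitrary _
  -- A symmetric set of positive finite measure has equal mass under `μ` and `μ.inv`, which forces
  -- `c = 1`.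
  let S : Set G := (K : Set G) ∪ (K : Set G)⁻¹
  have hS0 : μ S ≠ 0 := ((Measure.measure_pos_of_nonempty_interior _ K.interior_nonempty).trans_le
    (measure_mono subset_union_left)).ne'
  have hS1 : μ S ≠ ∞ := (K.isCompact.union K.isCompact.inv).measure_lt_top.ne
  have hS : S⁻¹ = S := by simp [S, union_comm]
  have h : (c : ℝ≥0∞) * μ S = 1 * μ S := by
    have := congrArg (fun ν : Measure G => ν S) hc
    rw [Measure.inv_apply, hS, Measure.smul_apply, ENNReal.smul_def, smul_eq_mul] at this
    rw [one_mul, ← this]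
  have hc1 : (c : ℝ≥0∞) = 1 := (ENNReal.mul_left_inj hS0 hS1).1 h
  rw [hc, ENNReal.coe_eq_one.1 hc1, one_smul]

namespace SimplePointProcess

/-! ### Atoms of the process and sums over its points. -/

section Counting

variable {Ω X : Type*} [MeasurableSpace Ω] [TopologicalSpace X] [MeasurableSpace X]

theorem toMeasure_singleton [MeasurableSingletonClass X]
    (m : SimplePointProcess Ω X) (ω : Ω) (x : X) :
    m.toMeasure ω {x} ≠ 0 ↔ x ∈ m.points ω := by
  rw [toMeasure, countingMeasure, Measure.restrict_apply (measurableSet_singleton x)]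
  by_cases h : x ∈ m.points ω
  · simp [h]
  · simp [h]

theorem measurableSet_mem_points [MeasurableSingletonClass X]
    (m : SimplePointProcess Ω X) (x : X) : MeasurableSet {ω | x ∈ m.points ω} := by
  simp_rw [← toMeasure_singleton]
  exact (m.measurable_count {x} (measurableSet_singleton x)
    (measurableSet_singleton (0 : ℝ≥0∞))).compl

theorem lintegral_toMeasure (m : SimplePointProcess Ω X) {ω : Ω}
    (hω : MeasurableSet (m.points ω)) {f : X → ℝ≥0∞} (hf : Measurable f) :
    ∫⁻ x, f x ∂(m.toMeasure ω) = ∑' x : m.points ω, f x := by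
  rw [toMeasure, countingMeasure, ← lintegral_indicator hω,
    lintegral_count' (hf.indicator hω), tsum_subtype]

end Counting

/-! ### Flow-adapted processes, their intensity and their Palm measure. -/

section Flow

variable {Ω X : Type*} [MeasurableSpace Ω] [Group X] [TopologicalSpace X]
  [MeasurableSpace X] [BorelSpace X] [MulAction X Ω] {m : SimplePointProcess Ω X}

theorem FlowAdapted.mem_points_smul [T2Space X] (hm : m.FlowAdapted) (x y : X) (ω : Ω) :
    y ∈ m.points (x • ω) ↔ x⁻¹ * y ∈ m.points ω := by
  rw [← toMeasure_singleton, ← toMeasure_singleton, hm x ω {y} (measurableSet_singleton y),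
    Set.smul_set_singleton, smul_eq_mul]

variable [IsTopologicalGroup X]

theorem FlowAdapted.toMeasure_smul (hm : m.FlowAdapted) (x : X) (ω : Ω) :
    m.toMeasure (x • ω) = (m.toMeasure ω).map fun y => x * y := by
  ext B hB
  rw [hm x ω B hB, Measure.map_apply (measurable_const_mul x) hB, ← Set.preimage_smul]
  rfl

theorem FlowAdapted.lintegral_smul (hm : m.FlowAdapted) (x : X) (ω : Ω) {f : X → ℝ≥0∞}
    (hf : Measurable f) :
    ∫⁻ y, f y ∂(m.toMeasure (x • ω)) = ∫⁻ y, f (x * y) ∂(m.toMeasure ω) := by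
  rw [hm.toMeasure_smul, lintegral_map hf (measurable_const_mul x)]

variable {P : Measure Ω}

theorem FlowAdapted.meanMeasure_isMulLeftInvariant [MeasurableConstSMul X Ω]
    [SMulInvariantMeasure X Ω P] (hm : m.FlowAdapted) :
    (m.meanMeasure P).IsMulLeftInvariant := by
  refine ⟨fun x => ?_⟩
  ext B hB
  have hxB : MeasurableSet ((fun y => x * y) ⁻¹' B) := measurable_const_mul x hB
  rw [Measure.map_apply (measurable_const_mul x) hB, meanMeasure,
    Measure.bind_apply hxB m.measurable_toMeasure.aemeasurable,
    Measure.bind_apply hB m.measurable_toMeasure.aemeasurable,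
    ← (measurePreserving_smul x P).lintegral_comp
      (show Measurable fun ω => m.toMeasure ω B from m.measurable_count B hB)]
  refine lintegral_congr fun ω => ?_
  rw [hm.toMeasure_smul, Measure.map_apply (measurable_const_mul x) hB]

variable [T2Space X] [SecondCountableTopology X] [MeasurableSMul₂ X Ω]

/-- Since `x ∈ m(ω)` exactly when `e ∈ m(x⁻¹ω)`, joint measurability of the action reduces the claim
to the single event `{e ∈ m}`. -/
theorem FlowAdapted.measurableSet_prod (hm : m.FlowAdapted) :
    MeasurableSet {p : Ω × X | p.2 ∈ m.points p.1} := by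
  have h : {p : Ω × X | p.2 ∈ m.points p.1} =
      (fun p : Ω × X => p.2⁻¹ • p.1) ⁻¹' {ω | (1 : X) ∈ m.points ω} := by
    ext p
    simp [hm.mem_points_smul]
  rw [h]
  exact (measurable_snd.inv.smul measurable_fst) (m.measurableSet_mem_points 1)

theorem FlowAdapted.measurableSet_points (hm : m.FlowAdapted) (ω : Ω) :
    MeasurableSet (m.points ω) :=
  measurable_prodMk_left hm.measurableSet_prod

variable [LocallyCompactSpace X]

/-- A left-invariant locally finite measure is a finite multiple of Haar measure; evaluating at `B`
identifies the factor as the intensity, which is why the choice of `B` is immaterial. -/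
theorem FlowAdapted.meanMeasure_eq_smul [SMulInvariantMeasure X Ω P] (hm : m.FlowAdapted)
    [IsLocallyFiniteMeasure (m.meanMeasure P)]
    (haar : Measure X) [haar.IsHaarMeasure] {B : Set X} (hB0 : haar B ≠ 0) (hB1 : haar B ≠ ∞) :
    m.meanMeasure P = m.intensity P haar B • haar ∧ m.intensity P haar B ≠ ∞ := by
  have := hm.meanMeasure_isMulLeftInvariant (P := P)
  have h := Measure.isMulLeftInvariant_eq_smul (m.meanMeasure P) haar
  have hc : m.intensity P haar B = (m.meanMeasure P).haarScalarFactor haar := by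
    rw [intensity]
    conv_lhs => rw [h]
    rw [Measure.smul_apply, ENNReal.smul_def, smul_eq_mul, ENNReal.mul_div_cancel_right hB0 hB1]
  rw [hc]
  exact ⟨h, ENNReal.coe_ne_top⟩

/-- Integration with respect to the Palm measure. -/
theorem lintegral_palm (m : SimplePointProcess Ω X) (haar : Measure X) (B : Set X) {w : X → ℝ≥0}
    (hw : Measurable w) {f : Ω → ℝ≥0∞} (hf : Measurable f) :
    ∫⁻ ω, f ω ∂(m.palm P haar B w) = (m.intensity P haar B)⁻¹ *
      ∫⁻ ω, ∫⁻ x, w x * f (x⁻¹ • ω) ∂(m.toMeasure ω) ∂P := by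
  have hsm : Measurable fun p : Ω × X => p.2⁻¹ • p.1 := measurable_snd.inv.smul measurable_fst
  have hω : ∀ ω : Ω, Measurable fun x : X => x⁻¹ • ω := fun ω =>
    hsm.comp (measurable_const.prodMk measurable_id)
  have key : ∀ {f : Ω → ℝ≥0∞}, Measurable f → ∀ ω : Ω,
      ∫⁻ y, f y ∂((m.toMeasure ω).withDensity fun x => (w x : ℝ≥0∞)).map (fun x => x⁻¹ • ω) =
        ∫⁻ x, w x * f (x⁻¹ • ω) ∂(m.toMeasure ω) := by
    intro f hf ω
    rw [lintegral_map hf (hω ω),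
      lintegral_withDensity_eq_lintegral_mul _ hw.coe_nnreal_ennreal
        (show Measurable fun x => f (x⁻¹ • ω) from hf.comp (hω ω))]
    rfl
  have hmeas : Measurable fun ω =>
      ((m.toMeasure ω).withDensity fun x => (w x : ℝ≥0∞)).map fun x => x⁻¹ • ω := by
    refine Measure.measurable_of_measurable_coe _ fun A hA => ?_
    simp_rw [← lintegral_indicator_one hA, key (measurable_one.indicator hA)]
    exact Measurable.lintegral_kernel_prod_right' (κ := m.toKernel)
      ((hw.comp measurable_snd).coe_nnreal_ennreal.mul
        ((measurable_one.indicator hA).comp hsm))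
  rw [palm, lintegral_smul_measure, smul_eq_mul,
    Measure.lintegral_bind hmeas.aemeasurable hf.aemeasurable]
  simp_rw [key hf]

theorem FlowAdapted.isProbabilityMeasure_palm [SMulInvariantMeasure X Ω P] (hm : m.FlowAdapted)
    [IsLocallyFiniteMeasure (m.meanMeasure P)] (hpos : m.meanMeasure P ≠ 0)
    (haar : Measure X) [haar.IsHaarMeasure] {B : Set X} (hB0 : haar B ≠ 0) (hB1 : haar B ≠ ∞)
    {w : X → ℝ≥0} (hw : Measurable w) (hw1 : ∫⁻ x, (w x : ℝ≥0∞) ∂haar = 1) :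
    IsProbabilityMeasure (m.palm P haar B w) := by
  obtain ⟨h, hc⟩ := hm.meanMeasure_eq_smul (P := P) haar hB0 hB1
  have hc0 : m.intensity P haar B ≠ 0 := fun h0 => hpos (by rw [h, h0, zero_smul])
  constructor
  rw [← lintegral_one, lintegral_palm m haar B hw measurable_const]
  simp_rw [mul_one]
  -- Campbell's formula: `𝐄 ∫ w dm` is the integral of `w` against the mean measure, that is `c ∫ w
  -- dλ = c`.
  rw [← Measure.lintegral_bind m.measurable_toMeasure.aemeasurable
    hw.coe_nnreal_ennreal.aemeasurable]
  change _ * ∫⁻ x, (w x : ℝ≥0∞) ∂(m.meanMeasure P) = 1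
  rw [h, lintegral_smul_measure, hw1, smul_eq_mul, mul_one, ENNReal.inv_mul_cancel hc0 hc]

/-- Almost surely for the Palm measure, the neutral element is a point of the process. -/
theorem FlowAdapted.palm_compl_mem_points (hm : m.FlowAdapted) (haar : Measure X) (B : Set X)
    {w : X → ℝ≥0} (hw : Measurable w) :
    m.palm P haar B w {ω | (1 : X) ∈ m.points ω}ᶜ = 0 := by
  have hE := (m.measurableSet_mem_points (1 : X)).compl
  rw [← lintegral_indicator_one hE, lintegral_palm m haar B hw (measurable_one.indicator hE)]
  refine mul_eq_zero_of_right _ ?_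
  rw [← lintegral_zero (μ := P)]
  refine lintegral_congr fun ω => ?_
  -- If `x` is a point of `m(ω)`, then `e = x⁻¹x` is one of `m(x⁻¹ω)`, so the integrand vanishes at
  -- every point of the process.
  rw [toMeasure, countingMeasure,
    setLIntegral_congr_fun (g := fun _ => 0) (hm.measurableSet_points ω), lintegral_zero]
  intro x hx
  simp [hm.mem_points_smul, hx]

end Flow

/-! ### Mass transport between points of a stationary process. -/

/-- The mass-transport principle: a diagonally invariant transport of mass between the points of a
stationary point process sends out as much mass as it brings in. -/
theorem FlowAdapted.massTransport {Ω X : Type*} [MeasurableSpace Ω] [Group X] [TopologicalSpace X]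
    [IsTopologicalGroup X] [LocallyCompactSpace X] [SecondCountableTopology X] [T2Space X]
    [MeasurableSpace X] [BorelSpace X] [MulAction X Ω] [MeasurableSMul₂ X Ω]
    {m : SimplePointProcess Ω X} (hm : m.FlowAdapted)
    {P : Measure Ω} [SFinite P] [SMulInvariantMeasure X Ω P]
    (haar : Measure X) [haar.IsHaarMeasure] [haar.IsMulRightInvariant]
    {w : X → ℝ≥0} (hw : Measurable w) (hw1 : ∫⁻ x, (w x : ℝ≥0∞) ∂haar = 1)
    {H : Ω × X × X → ℝ≥0∞} (hH : Measurable H)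
    (hinv : ∀ s ω y z, H (s • ω, s * y, s * z) = H (ω, y, z)) :
    ∫⁻ ω, ∫⁻ y, ∫⁻ z, w y * H (ω, y, z) ∂(m.toMeasure ω) ∂(m.toMeasure ω) ∂P =
      ∫⁻ ω, ∫⁻ y, ∫⁻ z, w z * H (ω, y, z) ∂(m.toMeasure ω) ∂(m.toMeasure ω) ∂P := by
  have := isInvInvariant_of_isMulRightInvariant haar
  let μ : Measure (Ω × X × X) := P ⊗ₘ (m.toKernel ×ₖ m.toKernel)
  have hμ : ∀ {f : Ω × X × X → ℝ≥0∞}, Measurable f → ∫⁻ p, f p ∂μ =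
      ∫⁻ ω, ∫⁻ y, ∫⁻ z, f (ω, y, z) ∂(m.toMeasure ω) ∂(m.toMeasure ω) ∂P := by
    intro f hf
    rw [Measure.lintegral_compProd hf]
    exact lintegral_congr fun ω =>
      Kernel.lintegral_prod _ _ ω (hf.comp measurable_prodMk_left)
  have hw' : Measurable fun x => (w x : ℝ≥0∞) := hw.coe_nnreal_ennreal
  have hone : ∀ x : X, ∫⁻ s, (w (s * x) : ℝ≥0∞) ∂haar = 1 := fun x => by
    rw [lintegral_mul_right_eq_self (fun s => (w s : ℝ≥0∞)), hw1]
  have hone' : ∀ x : X, ∫⁻ s, (w (s⁻¹ * x) : ℝ≥0∞) ∂haar = 1 := fun x => by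
    rw [lintegral_inv_eq_self (fun s => (w (s * x) : ℝ≥0∞)), hone]
  -- Invariance of `μ` under the diagonal shift by `s`: `P` is invariant, and `m(sω)` is the image
  -- of `m(ω)` under left translation by `s`.
  have hmul : ∀ (s : X) {f : Ω × X × X → ℝ≥0∞}, Measurable f →
      ∫⁻ p, f (s • p.1, s * p.2.1, s * p.2.2) ∂μ = ∫⁻ p, f p ∂μ := by
    intro s f hf
    have hs : Measurable fun p : Ω × X × X => (s • p.1, s * p.2.1, s * p.2.2) := by fun_prop
    have hint : Measurable fun ω =>
        ∫⁻ q, f (ω, q) ∂(m.toKernel ×ₖ m.toKernel) ω := hf.lintegral_kernel_prod_right'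
    rw [hμ (f := fun p => f (s • p.1, s * p.2.1, s * p.2.2)) (hf.comp hs), Measure.lintegral_compProd hf,
      ← (measurePreserving_smul s P).lintegral_comp hint]
    refine lintegral_congr fun ω => ?_
    have hfω : Measurable fun q : X × X => f (s • ω, q) := hf.comp measurable_prodMk_left
    rw [Kernel.lintegral_prod _ _ _ hfω]
    change _ = ∫⁻ y, ∫⁻ z, f (s • ω, y, z) ∂(m.toMeasure (s • ω)) ∂(m.toMeasure (s • ω))
    rw [hm.lintegral_smul s ω]
    · exact lintegral_congr fun y => (hm.lintegral_smul s ω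
        (f := fun z => f (s • ω, s * y, z)) (hfω.comp measurable_prodMk_left)).symm
    · have : SFinite (m.toMeasure (s • ω)) := IsSFiniteKernel.sFinite (κ := m.toKernel) (s • ω)
      exact Measurable.lintegral_kernel_prod_right' (κ := Kernel.const X (m.toMeasure (s • ω)))
        hfω
  have hwy : Measurable fun p : Ω × X × X => (w p.2.1 : ℝ≥0∞) := by fun_prop
  have hwz : Measurable fun p : Ω × X × X => (w p.2.2 : ℝ≥0∞) := by fun_prop
  rw [← hμ (f := fun p => w p.2.1 * H p) (hwy.mul hH),
    ← hμ (f := fun p => w p.2.2 * H p) (hwz.mul hH)]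
  calc ∫⁻ p, w p.2.1 * H p ∂μ
      = ∫⁻ p, ∫⁻ s, w (s * p.2.2) * (w p.2.1 * H p) ∂haar ∂μ := by
        refine lintegral_congr fun p => ?_
        rw [lintegral_mul_const _ (by fun_prop), hone, one_mul]
    _ = ∫⁻ s, ∫⁻ p, w (s * p.2.2) * (w p.2.1 * H p) ∂μ ∂haar :=
        lintegral_lintegral_swap (by fun_prop)
    _ = ∫⁻ s, ∫⁻ p, w (s⁻¹ * p.2.1) * (w p.2.2 * H p) ∂μ ∂haar := by
        refine lintegral_congr fun s => ?_
        -- This `f` is chosen so that shifting by `s` turns `w(s⁻¹y) w(z)` into `w(y) w(sz)` and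
        -- leaves `H` fixed.
        rw [← hmul s (f := fun p => w (s⁻¹ * p.2.1) * (w p.2.2 * H p)) (by fun_prop)]
        refine lintegral_congr fun p => ?_
        rw [hinv, inv_mul_cancel_left]
        ring
    _ = ∫⁻ p, ∫⁻ s, w (s⁻¹ * p.2.1) * (w p.2.2 * H p) ∂haar ∂μ :=
        (lintegral_lintegral_swap (by fun_prop)).symm
    _ = ∫⁻ p, w p.2.2 * H p ∂μ := by
        refine lintegral_congr fun p => ?_
        rw [lintegral_mul_const _ (by fun_prop), hone', one_mul]

end SimplePointProcess

universe u v

/-! ### Rerooting a network by the flow. -/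

section Networks

variable {Ω : Type*} {X : Type u} [Group X] {Ξ : Type v}
  {β : Ω → NetworkIn Ξ X}

open Classical in
/-- `(ω, x) ↦ g [β ω, e, x]`, extended by `0` to the pairs for which `e` or `x` is not a vertex. -/
noncomputable def massAtOne (β : Ω → NetworkIn Ξ X) (g : BirootedClass.{u, v} Ξ → ℝ≥0)
    (p : Ω × X) : ℝ≥0∞ :=
  if h : (1 : X) ∈ (β p.1).verts ∧ p.2 ∈ (β p.1).verts then
    g (birootedAtOne β ⟨p, h⟩) else 0

theorem measurable_massAtOne [MeasurableSpace Ω] [MeasurableSpace X] [MetricSpace Ξ]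
    (hset : MeasurableSet {p : Ω × X | (1 : X) ∈ (β p.1).verts ∧ p.2 ∈ (β p.1).verts})
    (hβ : Measurable (birootedAtOne β)) {g : BirootedClass.{u, v} Ξ → ℝ≥0} (hg : Measurable g) :
    Measurable (massAtOne β g) := by
  classical
  exact Measurable.dite (s := {p : Ω × X | (1 : X) ∈ (β p.1).verts ∧ p.2 ∈ (β p.1).verts})
    (hg.comp hβ).coe_nnreal_ennreal measurable_const hset

variable [MulAction X Ω]

theorem NetworkFlowAdapted.mem_verts_smul (hβ : NetworkFlowAdapted β) {z : X} {ω : Ω} {x : X} :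
    z * x ∈ (β (z • ω)).verts ↔ x ∈ (β ω).verts := by
  rw [(hβ z ω).1]
  exact (mul_right_injective z).mem_set_image

/-- Left translation by `z` is itself the isomorphism. The shifted vertices are free variables `x'`,
`y'` tied by equations, so that `e` can stand for `y⁻¹ * y` without rewriting inside a membership
proof. -/
theorem NetworkFlowAdapted.birootedClass_smul (hβ : NetworkFlowAdapted β) (z : X) (ω : Ω)
    {x y : X} (hx : x ∈ (β ω).verts) (hy : y ∈ (β ω).verts) {x' y' : X}
    (hx' : x' ∈ (β (z • ω)).verts) (hy' : y' ∈ (β (z • ω)).verts)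
    (hxx : z * x = x') (hyy : z * y = y') :
    birootedClass (β (z • ω)).net ⟨x', hx'⟩ ⟨y', hy'⟩ =
      birootedClass (β ω).net ⟨x, hx⟩ ⟨y, hy⟩ := by
  subst hxx hyy
  let φ : (β ω).verts ≃ (β (z • ω)).verts :=
    (Equiv.mulLeft z).subtypeEquiv fun _ => hβ.mem_verts_smul.symm
  have hφ : (β ω).net.IsIso (β (z • ω)).net φ := by
    refine ⟨fun a b => ?_, fun a => ?_, fun a b h h' => ?_⟩
    · exact ((hβ z ω).2 a b a.2 b.2 (φ a).2 (φ b).2).1.symm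
    · exact ((hβ z ω).2 a a a.2 a.2 (φ a).2 (φ a).2).2.1.symm
    · exact (((hβ z ω).2 a b a.2 b.2 (φ a).2 (φ b).2).2.2 h' h).symm
  exact (Quotient.sound (s := BirootedNetwork.setoid Ξ) ⟨φ, hφ, rfl, rfl⟩).symm

theorem NetworkFlowAdapted.massAtOne_inv_smul (hβ : NetworkFlowAdapted β)
    (g : BirootedClass.{u, v} Ξ → ℝ≥0) {ω : Ω} {y z : X} (hy : y ∈ (β ω).verts)
    (hz : z ∈ (β ω).verts) :
    massAtOne β g (y⁻¹ • ω, y⁻¹ * z) = g (birootedClass (β ω).net ⟨y, hy⟩ ⟨z, hz⟩) := by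
  have h1 : (1 : X) ∈ (β (y⁻¹ • ω)).verts := by
    rw [← inv_mul_cancel y]
    exact hβ.mem_verts_smul.2 hy
  rw [massAtOne, dif_pos ⟨h1, hβ.mem_verts_smul.2 hz⟩, birootedAtOne]
  exact congrArg (fun c => (g c : ℝ≥0∞))
    (hβ.birootedClass_smul y⁻¹ ω hy hz _ _ (inv_mul_cancel y) rfl)

end Networks

end FlowNet

/-! ### Unimodularity under the Palm measure. -/

theorem mainTheorem11 {X : Type*} [Group X] [TopologicalSpace X] [IsTopologicalGroup X]
    [LocallyCompactSpace X] [SecondCountableTopology X] [T2Space X]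
    [MeasurableSpace X] [BorelSpace X]
    -- a left Haar measure, and unimodularity of the group
    (haar : Measure X) [haar.IsHaarMeasure] (hX : haar.IsMulRightInvariant)
    -- the stationary framework
    {Ω : Type*} [MeasurableSpace Ω] (P : Measure Ω) [IsProbabilityMeasure P]
    [MulAction X Ω] [MeasurableSMul₂ X Ω] [SMulInvariantMeasure X Ω P]
    -- the point process, with intensity in `(0, ∞)`
    (m : FlowNet.SimplePointProcess Ω X) (hm : m.FlowAdapted)
    (hfin : IsLocallyFiniteMeasure (m.meanMeasure P)) (hpos : m.meanMeasure P ≠ 0)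
    -- the reference set and the weight function in the definition of the Palm measure
    (B : Set X) (hB : MeasurableSet B) (hB0 : haar B ≠ 0) (hB1 : haar B ≠ ∞)
    (w : X → ℝ≥0) (hw : Measurable w) (hw1 : ∫⁻ x, (w x : ℝ≥0∞) ∂haar = 1)
    -- the network
    {Ξ : Type*} [MetricSpace Ξ] [CompleteSpace Ξ] [TopologicalSpace.SeparableSpace Ξ]
    (β : Ω → FlowNet.NetworkIn Ξ X)
    (hV : ∀ ω, (β ω).verts = m.points ω)
    (hβ : FlowNet.NetworkFlowAdapted β)
    (hmeas : Measurable (FlowNet.rootedAtOne β))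
    (hmeas₂ : Measurable (FlowNet.birootedAtOne β)) :
    MeasurableSet {ω : Ω | (1 : X) ∈ (β ω).verts} ∧
    IsProbabilityMeasure (m.palm P haar B w) ∧
    FlowNet.IsUnimodularRandomNetwork
      ((m.palm P haar B w).comap
        (Subtype.val : {ω : Ω // (1 : X) ∈ (β ω).verts} → Ω))
      (FlowNet.rootedAtOne β) := by
  have hiff : ∀ ω x, x ∈ (β ω).verts ↔ x ∈ m.points ω := fun ω x => by rw [hV]
  have hE : MeasurableSet {ω : Ω | (1 : X) ∈ (β ω).verts} := by
    simp_rw [hiff]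
    exact m.measurableSet_mem_points 1
  have hprob := hm.isProbabilityMeasure_palm (P := P) hpos haar hB0 hB1 hw hw1
  have hae : ∀ᵐ ω ∂(m.palm P haar B w), ω ∈ {ω : Ω | (1 : X) ∈ (β ω).verts} := by
    simp_rw [hiff]
    exact hm.palm_compl_mem_points haar B hw
  refine ⟨hE, hprob, ⟨⟨?_⟩, hmeas, fun g hg => ?_⟩⟩
  · refine (comap_subtype_coe_apply hE _ _).trans ?_
    rw [image_univ, Subtype.range_coe]
    exact (prob_compl_eq_zero_iff hE).1 hae
  have hset : MeasurableSet
      {p : Ω × X | (1 : X) ∈ (β p.1).verts ∧ p.2 ∈ (β p.1).verts} := by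
    simp_rw [hiff]
    exact (measurable_fst (m.measurableSet_mem_points 1)).inter hm.measurableSet_prod
  let G : Ω × X → ℝ≥0∞ := FlowNet.massAtOne β g
  have hG : Measurable G := FlowNet.measurable_massAtOne hset hmeas₂ hg
  have hG' : Measurable fun p : Ω × X => G (p.2⁻¹ • p.1, p.2⁻¹) :=
    hG.comp (by fun_prop)
  -- Equals `g[β(ω), y, z]` when `y` and `z` are vertices. Defining it through `G` on all of the
  -- product makes its measurability immediate and its diagonal invariance purely algebraic.
  let H : Ω × X × X → ℝ≥0∞ := fun p => G (p.2.1⁻¹ • p.1, p.2.1⁻¹ * p.2.2)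
  have hH : Measurable H := hG.comp (by fun_prop)
  have hinv : ∀ s ω y z, H (s • ω, s * y, s * z) = H (ω, y, z) := fun s ω y z => by
    simp [H, smul_smul, mul_assoc]
  have hout : ∀ ω : {ω : Ω // (1 : X) ∈ (β ω).verts},
      FlowNet.massOut g (FlowNet.rootedAtOne β ω) =
        ∫⁻ x, G (ω, x) ∂(m.toMeasure ω) := fun ω => by
    rw [m.lintegral_toMeasure (f := fun x => G (ω, x)) (hm.measurableSet_points _)
      (hG.comp measurable_prodMk_left),
      ← hV]
    refine tsum_congr fun x => ?_
    have := hβ.massAtOne_inv_smul g ω.2 x.2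
    simpa [G] using this.symm
  have hin : ∀ ω : {ω : Ω // (1 : X) ∈ (β ω).verts},
      FlowNet.massIn g (FlowNet.rootedAtOne β ω) =
        ∫⁻ x, G (x⁻¹ • ω, x⁻¹) ∂(m.toMeasure ω) := fun ω => by
    rw [m.lintegral_toMeasure (f := fun x => G (x⁻¹ • ω, x⁻¹)) (hm.measurableSet_points _)
      (hG'.comp measurable_prodMk_left), ← hV]
    refine tsum_congr fun x => ?_
    have := hβ.massAtOne_inv_smul g x.2 ω.2
    simpa [G] using this.symm
  simp_rw [hout, hin]
  -- Both integrands make sense on all of `Ω`, and the event has full Palm measure, so the integrals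
  -- over the subtype become Palm integrals.
  refine (lintegral_subtype_comap hE fun ω => ∫⁻ x, G (ω, x) ∂(m.toMeasure ω)).trans <| .trans ?_
    (lintegral_subtype_comap hE fun ω => ∫⁻ x, G (x⁻¹ • ω, x⁻¹) ∂(m.toMeasure ω)).symm
  rw [Measure.restrict_eq_self_of_ae_mem hae,
    m.lintegral_palm haar B hw (f := fun ω => ∫⁻ x, G (ω, x) ∂(m.toMeasure ω))
      (hG.lintegral_kernel_prod_right' (κ := m.toKernel)),
    m.lintegral_palm haar B hw (f := fun ω => ∫⁻ x, G (x⁻¹ • ω, x⁻¹) ∂(m.toMeasure ω))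
      (hG'.lintegral_kernel_prod_right' (κ := m.toKernel))]
  congr 1
  have hl : ∀ ω y, ∫⁻ x, G (y⁻¹ • ω, x) ∂(m.toMeasure (y⁻¹ • ω)) =
      ∫⁻ z, H (ω, y, z) ∂(m.toMeasure ω) := fun ω y =>
    hm.lintegral_smul y⁻¹ ω (hG.comp measurable_prodMk_left)
  -- Substituting `x = y⁻¹z` gives `x⁻¹y⁻¹ω = z⁻¹ω` and `x⁻¹ = z⁻¹y`, so the two points appear in
  -- `H` in reversed order.
  have hr : ∀ ω y, ∫⁻ x, G (x⁻¹ • y⁻¹ • ω, x⁻¹) ∂(m.toMeasure (y⁻¹ • ω)) =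
      ∫⁻ z, H (ω, z, y) ∂(m.toMeasure ω) := fun ω y => by
    rw [hm.lintegral_smul y⁻¹ ω (f := fun x => G (x⁻¹ • y⁻¹ • ω, x⁻¹))
      (hG'.comp measurable_prodMk_left)]
    refine lintegral_congr fun z => ?_
    simp [H, smul_smul]
  simp_rw [hl, hr]
  have hsf : ∀ ω, SFinite (m.toMeasure ω) := fun ω =>
    ProbabilityTheory.IsSFiniteKernel.sFinite (κ := m.toKernel) ω
  calc ∫⁻ ω, ∫⁻ y, w y * ∫⁻ z, H (ω, y, z) ∂(m.toMeasure ω) ∂(m.toMeasure ω) ∂P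
      = ∫⁻ ω, ∫⁻ y, ∫⁻ z, w y * H (ω, y, z) ∂(m.toMeasure ω) ∂(m.toMeasure ω) ∂P := by
        refine lintegral_congr fun ω => lintegral_congr fun y => ?_
        rw [lintegral_const_mul _ (by fun_prop)]
    _ = ∫⁻ ω, ∫⁻ y, ∫⁻ z, w z * H (ω, y, z) ∂(m.toMeasure ω) ∂(m.toMeasure ω) ∂P :=
        hm.massTransport haar hw hw1 hH hinv
    _ = ∫⁻ ω, ∫⁻ y, w y * ∫⁻ z, H (ω, z, y) ∂(m.toMeasure ω) ∂(m.toMeasure ω) ∂P := by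
        refine lintegral_congr fun ω => ?_
        -- Exchanging the two sums makes the weighted receiver the outer variable, as in the Palm
        -- formula for incoming mass.
        rw [lintegral_lintegral_swap (by fun_prop)]
        refine lintegral_congr fun y => ?_
        rw [lintegral_const_mul _ (by fun_prop)]
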